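/- Let $S^3$ be a three-dimensional piecewise flat manifold: a (locally finite) simplicial complex homeomorphic to a 3-manifold, formed by Euclidean tetrahedra whose metrics agree on common faces. For an edge (hinge) $h$ let $|h|$ be its length and $\epsilon_h$ its deficit angle, i.e. $2\pi$ minus the sum of the dihedral angles at $h$. Let $\{V_v\}$ be a dual tessellation: pairwise disjoint open sets $V_v$, one for each vertex, such that $v$ is the only vertex in $V_v$, only edges with endpoint $v$ meet $V_v$, and the $V_v$ cover $S^3$ up to a set of measure zero in volume, and in length on each edge. Let $\ell$ be an edge with endpoints $v,w$. For $p\in\ell$ let $P_\ell(p)$ be the surface orthogonal to $\ell$ at $p$: in the star of $\ell$ it consists of the planes orthogonal to $\ell$ at $p$, and it is extended throughout $V_v\cup V_w$ by developing it around both sides of each further hinge $h$ that it meets. That is, the surfaces remain parallel, and near $h$ they have, in cylindrical coordinates $(\rho,\phi,z)$ around $h$ with $\phi$ of period $2\pi-\epsilon_h$, the form $z\cos\theta_h+\rho\cos\phi\,\sin\theta_h=\mathrm{const}$ for $|\phi|\le\pi-\epsilon_h/2$, with a corner along the radial line $|\phi|=\pi-\epsilon_h/2$; here $\theta_h\in[0,\pi/2]$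 is the angle between $h$ and (the developed direction of) $\ell$. Away from the hinges the surfaces are planar, or have a corner that emanates from a hinge. Assume that such an extension exists. Let the edge volume be $V_\ell=(V_v\cup V_w)\cap\bigcup_{p\in\ell}P_\ell(p)$, the part of the dual volumes of the endpoints of $\ell$ that is orthogonally related to $\ell$, and let $|V_\ell|$ be its volume. For a region of $P_\ell(p)$ enclosing a single intersection point with a hinge, the integral of the sectional curvature is defined as $\langle T(\vec u),\vec v\rangle$, where $\vec u,\vec v$ is an oriented orthonormal pair tangent to the surface and $T$ is parallel transport within the surface around the region; it is zero for a region enclosing no such point, and it is additive. Let $\mathcal K(p)$ be this integral over $P_\ell(p)\cap V_\ell$, and define the average sectional curvature orthogonal to $\ell$ over $V_\ell$ as $K_\ell=\frac1{|V_\ell|}\int_\ell\mathcal K(p)\,dp$. Then $\mathcal K$ is integrable on $\ell$ and, to leading order in the deficit angles, $$K_\ell=\frac1{|V_\ell|}\Big(|\ell|\,\epsilon_\ell+\sum_h|h\cap V_\ell|\,\cos^2\theta_h\,\epsilon_h\Big)+O(\epsilon^2),$$ where the sum is over the other edges $h$ that meet $V_\ell$. More precisely, there is a universal constant $C$ such that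 the error is at most $\frac{C}{|V_\ell|}\big(|\ell|\,\epsilon_\ell^2+\sum_h|h\cap V_\ell|\,\epsilon_h^2\big)$. -/

import Mathlib

open Set Filter Topology MeasureTheory

universe u

noncomputable section

/-- Euclidean three-space. -/
abbrev E3 : Type := EuclideanSpace ℝ (Fin 3)

/-- A homogeneous simplicial 3-complex with vertex set `V`, formed by Euclidean tetrahedra: each
tetrahedron `t` is given with non-degenerate positions `pos t` of its vertices in Euclidean
three-space, and the metrics that two tetrahedra induce on a common face agree. -/
structure PiecewiseFlatComplex (V : Type u) where
  tets : Set (Finset V)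
  card_tet : ∀ t ∈ tets, t.card = 4
  exists_tet : ∀ v, ∃ t ∈ tets, v ∈ t
  locallyFinite : ∀ v, {t ∈ tets | v ∈ t}.Finite
  pos : Finset V → V → E3
  affineIndependent : ∀ t ∈ tets, AffineIndependent ℝ (fun a : t => pos t a)
  dist_pos : ∀ t ∈ tets, ∀ t' ∈ tets, ∀ a b, a ∈ t → a ∈ t' → b ∈ t → b ∈ t' →
    dist (pos t a) (pos t b) = dist (pos t' a) (pos t' b)

namespace PiecewiseFlatComplex

variable {V : Type u} (S : PiecewiseFlatComplex V)

/-- The points of the complex, in barycentric coordinates. (By local finiteness the topology of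
pointwise convergence is the usual topology of the complex.) -/
def Space : Type u :=
  {x : V → ℝ // (∀ v, 0 ≤ x v) ∧ ∃ t ∈ S.tets, (∀ v, v ∉ t → x v = 0) ∧ ∑ v ∈ t, x v = 1}

instance : TopologicalSpace S.Space :=
  inferInstanceAs (TopologicalSpace {x : V → ℝ //
    (∀ v, 0 ≤ x v) ∧ ∃ t ∈ S.tets, (∀ v, v ∉ t → x v = 0) ∧ ∑ v ∈ t, x v = 1})

/-- The complex is a topological 3-manifold (without boundary). -/
def IsManifold : Prop := Nonempty (ChartedSpace E3 S.Space)

/-- The closed simplex with vertex set `s`. -/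
def closedSimplex (s : Finset V) : Set S.Space := {x | ∀ v, v ∉ s → x.1 v = 0}

/-- The open simplex with vertex set `s`. -/
def openSimplex (s : Finset V) : Set S.Space := {x | ∀ v, v ∈ s ↔ 0 < x.1 v}

/-- The vertex `v` is the point `x`. -/
def IsVertex (v : V) (x : S.Space) : Prop := x ∈ S.openSimplex {v}

/-- The edges, which are the hinges in dimension three. -/
def edges : Set (Finset V) := {h | h.card = 2 ∧ ∃ t ∈ S.tets, h ⊆ t}

/-- The points lying on some (open) hinge. -/
def hingePoints : Set S.Space := {x | ∃ h ∈ S.edges, x ∈ S.openSimplex h}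

/-- The Euclidean position of a point in a tetrahedron `t` containing it. -/
def chart (t : Finset V) (x : S.Space) : E3 := ∑ v ∈ t, x.1 v • S.pos t v

/-- The 3-volume of a set. -/
def volume (A : Set S.Space) : ENNReal :=
  ∑' t : S.tets, MeasureTheory.volume (S.chart t.1 '' (A ∩ S.closedSimplex t.1))

/-- Some tetrahedron having the edge `h`. -/
def someTet (h : Finset V) : Finset V := Classical.epsilon fun t => t ∈ S.tets ∧ h ⊆ t

/-- `|h ∩ A|`: the length of the part of the edge `h` in `A`. Since metrics agree on common faces,
the tetrahedron in which the length is measured does not matter. -/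
def lengthIn (h : Finset V) (A : Set S.Space) : ℝ :=
  (Measure.hausdorffMeasure 1 (S.chart (S.someTet h) '' (A ∩ S.closedSimplex h))).toReal

/-- The length of an edge. -/
def length (h : Finset V) : ℝ := S.lengthIn h univ

/-- The unit vector from `a` to `b`, in the tetrahedron `t`. -/
def dir (t : Finset V) (a b : V) : E3 :=
  ‖S.pos t b - S.pos t a‖⁻¹ • (S.pos t b - S.pos t a)

/-- The signed distance from `a` of the orthogonal projection of `x` to the line `ab`, in `t`. -/
def axial (t : Finset V) (a b : V) (x : S.Space) : ℝ :=
  inner ℝ (S.dir t a b) (S.chart t x - S.pos t a)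

/-- The component orthogonal to `h` of the vector from the line of `h` to `y`, in `t`. -/
def perp (t h : Finset V) (y : E3) : E3 :=
  (vectorSpan ℝ (S.pos t '' (h : Set V)))ᗮ.starProjection (y - h.centroid ℝ (S.pos t))

section Angles

variable [DecidableEq V]

/-- The dihedral angle at the edge `h` of the tetrahedron `t`: the angle, in a plane orthogonal
to `h`, between the two faces containing `h`. (`t \ h` has two elements `c`, `d`, so the sum has
the two equal terms for `(c, d)` and `(d, c)`.) -/
def dihedral (t h : Finset V) : ℝ :=
  (∑ p ∈ (t \ h).offDiag,
    InnerProductGeometry.angle (S.perp t h (S.pos t p.1)) (S.perp t h (S.pos t p.2))) / 2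

/-- The total angle around a hinge. -/
def coneAngle (h : Finset V) : ℝ := ∑ᶠ t ∈ {t ∈ S.tets | h ⊆ t}, S.dihedral t h

/-- The deficit angle of a hinge. -/
def deficit (h : Finset V) : ℝ := 2 * Real.pi - S.coneAngle h

/-- `φ` is the angular coordinate of a system of cylindrical coordinates in the star of `h`: it is
periodic in `2π - ε_h`, it measures angles around `h` in each tetrahedron, and it separates
the half-planes bounded by `h`. -/
def IsAngularCoordinate (h : Finset V) (φ : S.Space → AddCircle (S.coneAngle h)) : Prop :=
  (∀ t ∈ S.tets, h ⊆ t → ∃ φt : S.Space → ℝ,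
    ∀ x ∈ S.closedSimplex t \ S.closedSimplex h, ∀ y ∈ S.closedSimplex t \ S.closedSimplex h,
      φ x = (φt x : AddCircle (S.coneAngle h)) ∧
      InnerProductGeometry.angle (S.perp t h (S.chart t x)) (S.perp t h (S.chart t y)) =
        |φt x - φt y|) ∧
  (∀ t ∈ S.tets, h ⊆ t → ∀ t' ∈ S.tets, h ⊆ t' →
    ∀ x ∈ S.closedSimplex t \ S.closedSimplex h, ∀ y ∈ S.closedSimplex t' \ S.closedSimplex h,
      φ x = φ y → ∃ t'' ∈ S.tets, h ⊆ t'' ∧ x ∈ S.closedSimplex t'' ∧ y ∈ S.closedSimplex t'' ∧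
        InnerProductGeometry.angle (S.perp t'' h (S.chart t'' x))
          (S.perp t'' h (S.chart t'' y)) = 0)

/-- Near the point `q` of the hinge `h`, the level sets of `f` are the parallel surfaces
`P_h^θ` that make the angle `θ` with the planes orthogonal to `h`, and `f` measures the distance
between them. In cylindrical coordinates `(ρ, φ, z)` around `h` these surfaces are
`z cos θ + ρ cos φ sin θ = const`, developed from the radial line `φ = 0` around both sides of `h`
until the two sides meet, with a corner, at the opposite radial line. (The norm of an element
of the circle is its distance from `0`.) -/
def IsTiltedFoliationAt (h : Finset V) (θ : ℝ) (f : S.Space → ℝ) (q : S.Space) : Prop :=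
  ∃ a b, h = {a, b} ∧ ∃ φ : S.Space → AddCircle (S.coneAngle h), S.IsAngularCoordinate h φ ∧
    ∀ᶠ x in 𝓝 q, ∀ t ∈ S.tets, h ⊆ t → x ∈ S.closedSimplex t →
      f x = f q + Real.cos θ * (S.axial t a b x - S.axial t a b q) +
        Real.sin θ * ‖S.perp t h (S.chart t x)‖ * Real.cos ‖φ x‖

end Angles

/-- `ψ` develops a neighbourhood of `x`, isometrically on each tetrahedron, into Euclidean
three-space. -/
def IsDevelopmentAt (ψ : S.Space → E3) (x : S.Space) : Prop :=
  ∃ N ∈ 𝓝 x, InjOn ψ N ∧ ∀ t ∈ S.tets, ∀ y ∈ N ∩ S.closedSimplex t, ∀ z ∈ N ∩ S.closedSimplex t,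
    dist (ψ y) (ψ z) = dist (S.chart t y) (S.chart t z)

/-- Near `x`, the level sets of `f` are parallel planes and `f` measures the distance between
them. -/
def IsPlanarFoliationAt (f : S.Space → ℝ) (x : S.Space) : Prop :=
  ∃ (ψ : S.Space → E3) (n : E3), S.IsDevelopmentAt ψ x ∧ ‖n‖ = 1 ∧
    ∀ᶠ y in 𝓝 x, f y = f x + inner ℝ n (ψ y - ψ x)

/-- Near `x`, the level sets of `f` are pairs of half-planes meeting at a corner, which passes
through `x`. -/
def IsCorneredFoliationAt (f : S.Space → ℝ) (x : S.Space) : Prop :=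
  ∃ (ψ : S.Space → E3) (n₁ n₂ : E3), S.IsDevelopmentAt ψ x ∧ ‖n₁‖ = 1 ∧ ‖n₂‖ = 1 ∧
    n₁ ≠ n₂ ∧ n₁ ≠ -n₂ ∧
    ((∀ᶠ y in 𝓝 x, f y = f x + max (inner ℝ n₁ (ψ y - ψ x)) (inner ℝ n₂ (ψ y - ψ x))) ∨
     (∀ᶠ y in 𝓝 x, f y = f x + min (inner ℝ n₁ (ψ y - ψ x)) (inner ℝ n₂ (ψ y - ψ x))))

/-- A tessellation of the complex by open vertex volumes. The last condition says that the
boundaries of the volumes have measure zero in each hinge. -/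
structure IsDualTessellation (D : V → Set S.Space) : Prop where
  isOpen : ∀ v, IsOpen (D v)
  vertex_mem_iff : ∀ u v x, S.IsVertex u x → (x ∈ D v ↔ u = v)
  disjoint : Pairwise fun u v => Disjoint (D u) (D v)
  volume_compl : S.volume (⋃ v, D v)ᶜ = 0
  mem_of_inter : ∀ v, ∀ h ∈ S.edges, (D v ∩ S.openSimplex h).Nonempty → v ∈ h
  length_compl : ∀ h ∈ S.edges, S.lengthIn h (⋃ v, D v)ᶜ = 0

variable [DecidableEq V]

/-- The extension, throughout the vertex volumes `D v` and `D w`, of the surfaces orthogonal to the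
edge `ℓ = vw`. The surface `P_ℓ(p)` through the point `p` of `ℓ` at distance `s` from `v` is the
level set `{x ∈ domain | height x = s}`. -/
structure OrthogonalSurfaces (D : V → Set S.Space) (v w : V) where
  /-- the union of the surfaces -/
  domain : Set S.Space
  height : S.Space → ℝ
  /-- the angle `θ_h` between the hinge `h` and (the developed direction of) `ℓ` -/
  angle : Finset V → ℝ
  isOpen_domain : IsOpen domain
  height_mem : ∀ x ∈ domain, height x ∈ Ioo 0 (S.length {v, w})
  /-- In the star of `ℓ` the surfaces are the planes orthogonal to `ℓ`. -/
  orthogonal : ∀ t ∈ S.tets, v ∈ t → w ∈ t → ∀ x ∈ S.closedSimplex t, 0 < x.1 v → 0 < x.1 w →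
    (x ∈ domain ↔ S.axial t v w x ∈ Ioo 0 (S.length {v, w})) ∧
    (x ∈ domain → height x = S.axial t v w x)
  /-- Each surface is connected. -/
  connected : ∀ s ∈ Ioo 0 (S.length {v, w}), IsConnected {x ∈ domain | height x = s}
  /-- No surface ends inside the vertex volumes of `v` and `w`. -/
  complete : ∀ s₁ s₂, 0 < s₁ → s₂ < S.length {v, w} →
    closure {x ∈ domain | height x ∈ Icc s₁ s₂} ∩ (D v ∪ D w) ⊆ domain
  angle_mem : ∀ h, angle h ∈ Icc 0 (Real.pi / 2)
  /-- The angle is the Euclidean one if `h` and `ℓ` belong to a common tetrahedron. -/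
  cos_angle : ∀ t ∈ S.tets, v ∈ t → w ∈ t → ∀ a ∈ t, ∀ b ∈ t, a ≠ b →
    (S.openSimplex {a, b} ∩ domain).Nonempty →
    Real.cos (angle {a, b}) = |inner ℝ (S.dir t v w) (S.dir t a b)|
  /-- The surfaces are developed around both sides of each hinge that they meet. Elsewhere
  they are locally planes, or have a corner. -/
  developed : ∀ x ∈ domain,
    (∃ h ∈ S.edges, x ∈ S.openSimplex h ∧ S.IsTiltedFoliationAt h (angle h) height x) ∨
    ((∀ h ∈ S.edges, x ∉ S.closedSimplex h) ∧
      (S.IsPlanarFoliationAt height x ∨ S.IsCorneredFoliationAt height x))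
  /-- Within each surface the corners emanate from the hinges. -/
  corner : ∀ x ∈ domain, S.IsCorneredFoliationAt height x →
    ∃ q ∈ S.hingePoints, x ∈ connectedComponentIn {y ∈ domain | height y = height x ∧
      (y ∈ S.hingePoints ∨ S.IsCorneredFoliationAt height y)} q

end PiecewiseFlatComplex

/-- The unit normal of the surface `P_h^θ` developed into Euclidean three-space, with `h` on the
third coordinate axis; the developed surface lies in the plane `x sin θ + z cos θ = 0`. -/
def coneNormal (θ : ℝ) : E3 := !₂[Real.sin θ, 0, Real.cos θ]

/-- The rotation by a right angle in the plane of the developed surface. -/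
def coneTurn (θ : ℝ) (x : E3) : E3 :=
  WithLp.toLp 2 (crossProduct (coneNormal θ).ofLp x.ofLp)

/-- The unit vector in the plane of the developed surface over the direction `φ` orthogonal to
`h`. -/
def coneRay (θ φ : ℝ) : E3 :=
  let r : E3 := !₂[Real.cos θ * Real.cos φ, Real.cos θ * Real.sin φ, -(Real.sin θ * Real.cos φ)]
  ‖r‖⁻¹ • r

/-- Parallel transport within `P_h^θ` through the corner, where the total angle around `h` is `Θ`.
The radial lines `φ = Θ/2` and `φ = -Θ/2` of the developed surface represent the same line `k`,
the corner; the component of a vector along `k` and the component in the surface orthogonal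
to `k` are preserved. -/
def cornerTransport (θ Θ : ℝ) (x : E3) : E3 :=
  inner ℝ (coneRay θ (Θ / 2)) x • coneRay θ (-(Θ / 2)) +
    inner ℝ (coneTurn θ (coneRay θ (Θ / 2))) x • coneTurn θ (coneRay θ (-(Θ / 2)))

/-- `κ` is the integral of the sectional curvature over a region of `P_h^θ` enclosing its
intersection with `h`, where the total angle around `h` is `Θ`: it is the component along
`v` of the parallel transport within the surface of `u` around the region, for some orthonormal
pair `u, v` tangent to the surface. Here `X φ` is the parallel field along the boundary of
the region, as a function of the angular coordinate `φ`, with `X (-Θ/2) = u`; it is tangent to the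
surface, and the tangential part of its derivative is zero. -/
def IsIntegratedCurvature (θ Θ κ : ℝ) : Prop :=
  ∃ X : ℝ → E3, ‖X (-(Θ / 2))‖ = 1 ∧
    (∀ φ ∈ Icc (-(Θ / 2)) (Θ / 2), inner ℝ (coneNormal θ) (X φ) = 0 ∧
      ∃ c : ℝ, HasDerivWithinAt X (c • coneNormal θ) (Icc (-(Θ / 2)) (Θ / 2)) φ) ∧
    κ = inner ℝ (cornerTransport θ Θ (X (Θ / 2))) (coneTurn θ (X (-(Θ / 2))))

namespace PiecewiseFlatComplex.OrthogonalSurfaces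

variable {V : Type u} [DecidableEq V] {S : PiecewiseFlatComplex V} {D : V → Set S.Space} {v w : V}
  (P : S.OrthogonalSurfaces D v w)

/-- The edge volume `V_ℓ`. -/
def edgeVolume : Set S.Space := (D v ∪ D w) ∩ P.domain

/-- `κ q` is the integral of the sectional curvature over a region of the surface through `q`
enclosing `q` and no other intersection point with a hinge, for each hinge point `q` in `V_ℓ`. -/
def IsHingeCurvature (κ : S.Space → ℝ) : Prop :=
  ∀ h ∈ S.edges, ∀ q ∈ S.openSimplex h ∩ P.edgeVolume,
    IsIntegratedCurvature (P.angle h) (S.coneAngle h) (κ q)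

/-- The integral of the sectional curvature over `D(p) = P_ℓ(p) ∩ V_ℓ`, with `p` at distance `s`
from `v`: the sum over regions that each enclose one intersection point with a hinge. Regions
enclosing no hinge are flat, and do not contribute. -/
def surfaceCurvature (κ : S.Space → ℝ) (s : ℝ) : ℝ :=
  ∑ᶠ q ∈ {q ∈ P.edgeVolume | q ∈ S.hingePoints ∧ P.height q = s}, κ q

/-- The average over `V_ℓ` of the sectional curvature orthogonal to `ℓ`: the integral over `ℓ` of
the integrals over the surfaces, divided by the volume of `V_ℓ`. -/
def averageCurvature (κ : S.Space → ℝ) : ℝ :=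
  (∫ s in (0 : ℝ)..S.length {v, w}, P.surfaceCurvature κ s) / (S.volume P.edgeVolume).toReal

end PiecewiseFlatComplex.OrthogonalSurfaces

end

/-! The integral of the surface curvatures is an exact finite sum over hinges, and the deficit
angles are expanded only at the end. Write `c` for the cosine of `θ_h`. In the developed picture the
surface near a hinge is a plane with a wedge removed, and its half-angle has tangent `c * tan (ε_h /
2)`. A parallel field is constant in this plane, so the integrated curvature is the sine of the
wedge angle, the same number at every point of the hinge (`IsIntegratedCurvature.eq`). Along a hinge
the height is locally affine, with slope `± c` with respect to length. By the area formula
(`lintegral_count_fiber`), the number of intersection points with a surface, integrated over the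
surfaces, is `c * |h ∩ V_ℓ|`. Hence the total is the sum of `|h ∩ V_ℓ| * c * tiltedConeCurvature c
ε_h` (`integral_surfaceCurvature`). It runs over the finitely many edges at `v` or `w`, because no
other edge meets the two dual cells. Finally `c * tiltedConeCurvature c ε = c ^ 2 * ε + O(ε ^ 2)`
uniformly in `c` (`abs_mul_tiltedConeCurvature_sub_le`), and `ℓ` is the hinge with `c = 1` that lies
in `V_ℓ` up to a null set. -/

/-! ### The area formula on the line. -/

theorem volume_image_affine {σ : ℝ} (hσ : σ ≠ 0) (d : ℝ) {A : Set ℝ} (hA : MeasurableSet A) :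
    MeasurableSet ((fun x => σ * x + d) '' A) ∧
      volume ((fun x => σ * x + d) '' A) = ENNReal.ofReal |σ| * volume A := by
  have h : (fun x => σ * x + d) '' A =
      (fun y => σ⁻¹ * y) ⁻¹' ((fun y => y + -(σ⁻¹ * d)) ⁻¹' A) := by
    ext y
    simp only [mem_image, mem_preimage]
    constructor
    · rintro ⟨x, hx, rfl⟩
      convert hx using 1
      field_simp
      ring
    · intro hy
      exact ⟨_, hy, by field_simp; ring⟩
  rw [h]
  refine ⟨?_, ?_⟩
  · exact (measurable_const_mul _) ((measurable_add_const _) hA)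
  · rw [Real.volume_preimage_mul_left (inv_ne_zero hσ), inv_inv, measure_preimage_add_right]

/-- The area formula, with multiplicities, for a function on an open subset of the line that is
locally affine with slope `c` or `-c`. -/
theorem lintegral_count_fiber {U : Set ℝ} (hU : IsOpen U) {g : ℝ → ℝ} {c : ℝ} (hc : 0 < c)
    (hg : ∀ r ∈ U, ∃ σ : ℝ, |σ| = c ∧ ∀ᶠ x in 𝓝 r, g x = g r + σ * (x - r)) :
    Measurable (fun s => Measure.count {r | r ∈ U ∧ g r = s}) ∧
      ∫⁻ s, Measure.count {r | r ∈ U ∧ g r = s} = ENNReal.ofReal c * volume U := by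
  rcases U.eq_empty_or_nonempty with rfl | hne
  · simp
  have hN : ∀ r : ℝ, ∃ N : Set ℝ, ∃ σ d : ℝ, r ∈ U →
      (IsOpen N ∧ r ∈ N ∧ |σ| = c ∧ ∀ x ∈ N, g x = σ * x + d) := by
    intro r
    by_cases hr : r ∈ U
    · obtain ⟨σ, hσ, h⟩ := hg r hr
      obtain ⟨N, hN, hNo, hrN⟩ := eventually_nhds_iff.1 h
      exact ⟨N, σ, g r - σ * r, fun _ => ⟨hNo, hrN, hσ, fun x hx => by rw [hN x hx]; ring⟩⟩
    · exact ⟨∅, 0, 0, fun h => absurd h hr⟩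
  choose N σ d hN using hN
  -- Lindelöf: countably many neighbourhoods on which `g` is affine cover `U`. Made disjoint, they
  -- give pieces on which `g` is injective, so a fibre is counted by the indicators of the images of
  -- the pieces.
  obtain ⟨T, hTU, hTc, hT⟩ := TopologicalSpace.countable_cover_nhdsWithin (f := N) (s := U)
    fun r hr => mem_nhdsWithin_of_mem_nhds ((hN r hr).1.mem_nhds (hN r hr).2.1)
  have hTne : T.Nonempty := by
    obtain ⟨r, hr⟩ := hne
    obtain ⟨x, hx, -⟩ := mem_iUnion₂.1 (hT hr)
    exact ⟨x, hx⟩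
  obtain ⟨e, rfl⟩ := hTc.exists_eq_range hTne
  have he : ∀ n, e n ∈ U := fun n => hTU (mem_range_self n)
  set A : ℕ → Set ℝ := disjointed fun n => N (e n) ∩ U with hA
  have hAm : ∀ n, MeasurableSet (A n) := fun n =>
    MeasurableSet.disjointed (fun n => ((hN _ (he n)).1.inter hU).measurableSet) n
  have hAd : Pairwise (Function.onFun Disjoint A) := disjoint_disjointed _
  have hAU : ⋃ n, A n = U := by
    rw [hA, iUnion_disjointed]
    apply subset_antisymm (iUnion_subset fun n => inter_subset_right)
    intro x hx
    obtain ⟨_, ⟨n, rfl⟩, h⟩ := mem_iUnion₂.1 (hT hx)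
    exact mem_iUnion.2 ⟨n, h, hx⟩
  have hAN : ∀ n, ∀ x ∈ A n, g x = σ (e n) * x + d (e n) := fun n x hx =>
    (hN _ (he n)).2.2.2 x (disjointed_subset _ n hx).1
  have hσ : ∀ n, |σ (e n)| = c := fun n => (hN _ (he n)).2.2.1
  have hσ0 : ∀ n, σ (e n) ≠ 0 := fun n h => by have := hσ n; simp [h] at this; linarith
  have him : ∀ n, g '' A n = (fun x => σ (e n) * x + d (e n)) '' A n := fun n =>
    image_congr fun x hx => hAN n x hx
  have hgm : ∀ n, MeasurableSet (g '' A n) := fun n => by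
    rw [him]; exact (volume_image_affine (hσ0 n) _ (hAm n)).1
  have hsub : ∀ n s, {r | r ∈ A n ∧ g r = s}.Subsingleton := by
    rintro n s x ⟨hx, hxs⟩ y ⟨hy, hys⟩
    rw [hAN n x hx] at hxs
    rw [hAN n y hy] at hys
    exact mul_left_cancel₀ (hσ0 n) (by linarith)
  have key : ∀ s, Measure.count {r | r ∈ U ∧ g r = s} =
      ∑' n, (g '' A n).indicator (fun _ => (1 : ENNReal)) s := by
    intro s
    have h1 : {r | r ∈ U ∧ g r = s} = ⋃ n, {r | r ∈ A n ∧ g r = s} := by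
      ext r
      rw [← hAU]
      simp
    rw [h1, measure_iUnion]
    · congr 1
      ext n
      by_cases hs : s ∈ g '' A n
      · obtain ⟨r, hr, hrs⟩ := hs
        have : {r | r ∈ A n ∧ g r = s} = {r} := (hsub n s).eq_singleton_of_mem ⟨hr, hrs⟩
        have hmem : s ∈ g '' A n := ⟨r, hr, hrs⟩
        rw [this, indicator_of_mem hmem, Measure.count_singleton]
      · rw [indicator_of_notMem hs]
        have : {r | r ∈ A n ∧ g r = s} = ∅ := by
          ext r
          simp only [mem_empty_iff_false, iff_false]
          exact fun hr => hs ⟨r, hr⟩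
        rw [this, measure_empty]
    · intro i j hij
      exact (hAd hij).mono (fun x hx => hx.1) (fun x hx => hx.1)
    · exact fun n => (hsub n s).measurableSet
  simp_rw [key]
  have hm : ∀ n, Measurable ((g '' A n).indicator fun _ => (1 : ENNReal)) := fun n =>
    measurable_const.indicator (hgm n)
  refine ⟨Measurable.tsum hm, ?_⟩
  rw [lintegral_tsum fun n => (hm n).aemeasurable]
  simp_rw [lintegral_indicator (hgm _), setLIntegral_const, one_mul]
  simp_rw [him, fun n => (volume_image_affine (hσ0 n) (d (e n)) (hAm n)).2, hσ]
  rw [ENNReal.tsum_mul_left, ← measure_iUnion hAd hAm, hAU]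

/-! ### Expansion in the deficit angle. -/

/-- The sine of the deficit angle of the cone that a surface tilted by an angle with cosine `c`
cuts out around a hinge with deficit angle `ε`. -/
noncomputable def tiltedConeCurvature (c ε : ℝ) : ℝ :=
  c * Real.sin ε / (Real.cos (ε / 2) ^ 2 + c ^ 2 * Real.sin (ε / 2) ^ 2)

theorem abs_sin_sub_self_le (x : ℝ) : |Real.sin x - x| ≤ x ^ 2 := by
  wlog h : 0 ≤ x generalizing x
  · have := this (-x) (by linarith)
    rwa [Real.sin_neg, neg_sub_neg, neg_sq, abs_sub_comm] at this
  have h1 := Real.sin_le h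
  rw [abs_of_nonpos (by linarith)]
  rcases le_or_gt x 1 with hx | hx
  · rcases h.eq_or_lt with rfl | h0
    · simp
    · have := Real.sin_gt_sub_cube h0
      nlinarith [pow_nonneg h 2]
  · have := Real.neg_one_le_sin x
    rcases le_or_gt x 2 with h2 | h2
    · have : 0 ≤ Real.sin x := Real.sin_nonneg_of_nonneg_of_le_pi h (by linarith [Real.pi_gt_three])
      nlinarith
    · nlinarith

/-- With `D` the denominator, the difference is `c ^ 2 / D` times `(sin ε - ε) + ε * (1 - D)`. Since
`c ^ 2 ≤ D`, the prefactor is at most 1 even as `c` tends to 0. Each of the two terms is at most `ε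
^ 2`, the second because `1 - D ≤ sin (ε / 2) ^ 2 ≤ |ε|`. -/
theorem abs_mul_tiltedConeCurvature_sub_le {c : ℝ} (h0 : 0 ≤ c) (h1 : c ≤ 1) (ε : ℝ) :
    |c * tiltedConeCurvature c ε - c ^ 2 * ε| ≤ 2 * ε ^ 2 := by
  rcases h0.eq_or_lt with rfl | h0
  · simp; positivity
  have hs := Real.sin_sq_add_cos_sq (ε / 2)
  set D := Real.cos (ε / 2) ^ 2 + c ^ 2 * Real.sin (ε / 2) ^ 2 with hD
  have hc2 : c ^ 2 ≤ 1 := by nlinarith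
  have hcD : c ^ 2 ≤ D := by nlinarith [sq_nonneg (Real.cos (ε / 2))]
  have hDpos : 0 < D := lt_of_lt_of_le (by positivity) hcD
  have hD1 : 1 - D ≤ Real.sin (ε / 2) ^ 2 := by nlinarith [sq_nonneg (Real.sin (ε / 2))]
  have hD0 : 0 ≤ 1 - D := by nlinarith [sq_nonneg (Real.sin (ε / 2))]
  have hsin : Real.sin (ε / 2) ^ 2 ≤ |ε| := by
    have h2 : |Real.sin (ε / 2)| ≤ |ε / 2| := Real.abs_sin_le_abs
    have h3 : |Real.sin (ε / 2)| ≤ 1 := Real.abs_sin_le_one _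
    rw [abs_div, abs_two] at h2
    rw [← sq_abs]
    nlinarith [abs_nonneg (Real.sin (ε / 2)), abs_nonneg ε]
  have hq0 : 0 ≤ c ^ 2 / D := by positivity
  have hq1 : c ^ 2 / D ≤ 1 := (div_le_one hDpos).2 hcD
  have heq : c * tiltedConeCurvature c ε - c ^ 2 * ε =
      c ^ 2 / D * ((Real.sin ε - ε) + ε * (1 - D)) := by
    rw [tiltedConeCurvature, ← hD]
    field_simp
    ring
  rw [heq, abs_mul, abs_of_nonneg hq0]
  have h4 : |Real.sin ε - ε + ε * (1 - D)| ≤ 2 * ε ^ 2 := by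
    have h5 : |ε * (1 - D)| ≤ ε ^ 2 := by
      rw [abs_mul, abs_of_nonneg hD0, ← sq_abs, sq]
      exact mul_le_mul_of_nonneg_left (hD1.trans hsin) (abs_nonneg _)
    have := abs_add_le (Real.sin ε - ε) (ε * (1 - D))
    linarith [abs_sin_sub_self_le ε]
  calc _ ≤ 1 * |Real.sin ε - ε + ε * (1 - D)| := by gcongr
    _ ≤ _ := by linarith

/-! ### Parallel transport around a hinge. -/

theorem norm_coneNormal (θ : ℝ) : ‖coneNormal θ‖ = 1 := by
  rw [EuclideanSpace.norm_eq, Fin.sum_univ_three]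
  simp [coneNormal, Real.sin_sq_add_cos_sq]

theorem inner_fin_three (x y : E3) : inner ℝ x y = x 0 * y 0 + x 1 * y 1 + x 2 * y 2 := by
  simp [PiLp.inner_apply, Fin.sum_univ_three, mul_comm]

theorem coneTurn_apply (θ : ℝ) (x : E3) :
    coneTurn θ x 0 = -(Real.cos θ * x 1) ∧
    coneTurn θ x 1 = Real.cos θ * x 0 - Real.sin θ * x 2 ∧
    coneTurn θ x 2 = Real.sin θ * x 1 := by
  simp [coneTurn, cross_apply, coneNormal]

/-- A parallel field, developed into Euclidean space, is constant. -/
theorem eq_of_parallel {n : E3} (hn : ‖n‖ = 1) {X : ℝ → E3} {a b : ℝ} (hab : a ≤ b)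
    (h : ∀ φ ∈ Icc a b, inner ℝ n (X φ) = 0 ∧
      ∃ c : ℝ, HasDerivWithinAt X (c • n) (Icc a b) φ) : X b = X a := by
  rcases hab.eq_or_lt with rfl | hlt
  · rfl
  have hd : ∀ φ ∈ Icc a b, HasDerivWithinAt X 0 (Icc a b) φ := by
    intro φ hφ
    obtain ⟨-, c, hc⟩ := h φ hφ
    -- Differentiating the tangency condition `⟨n, X⟩ = 0` forces the normal derivative to vanish as
    -- well.
    have h1 : HasDerivWithinAt (fun x => inner ℝ n (X x)) (inner ℝ n (c • n)) (Icc a b) φ :=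
      ((innerSL ℝ n).hasFDerivAt.comp_hasDerivWithinAt φ hc)
    have h2 : HasDerivWithinAt (fun x => inner ℝ n (X x)) 0 (Icc a b) φ :=
      (hasDerivWithinAt_const φ (Icc a b) (0 : ℝ)).congr (fun x hx => (h x hx).1) (h φ hφ).1
    have h3 := (uniqueDiffOn_Icc hlt φ hφ).eq_deriv _ h1 h2
    rw [inner_smul_right, real_inner_self_eq_norm_sq, hn] at h3
    have : c = 0 := by simpa using h3
    simpa [this] using hc
  have hcont : ContinuousOn X (Icc a b) := fun φ hφ => (hd φ hφ).continuousWithinAt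
  exact constant_of_has_deriv_right_zero hcont
    (fun φ hφ => ((hd φ (Ico_subset_Icc_self hφ)).mono_of_mem_nhdsWithin
      (Icc_mem_nhdsGE_of_mem hφ))) b (right_mem_Icc.2 hab)

/-- The normalising factor is even in the angle, so one `N` serves both sides of the corner. Only `N
^ 2` is needed later. If the ray degenerates to 0, then `N = 0` and the formulas still hold. -/
theorem coneRay_apply (θ φ : ℝ) : ∃ N : ℝ,
    N ^ 2 = (Real.cos φ ^ 2 + Real.cos θ ^ 2 * Real.sin φ ^ 2)⁻¹ ∧
    ∀ ψ, (ψ = φ ∨ ψ = -φ) → coneRay θ ψ 0 = N * (Real.cos θ * Real.cos ψ) ∧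
      coneRay θ ψ 1 = N * (Real.cos θ * Real.sin ψ) ∧
      coneRay θ ψ 2 = N * -(Real.sin θ * Real.cos ψ) := by
  have hn : ∀ ψ, (ψ = φ ∨ ψ = -φ) →
      ‖(!₂[Real.cos θ * Real.cos ψ, Real.cos θ * Real.sin ψ, -(Real.sin θ * Real.cos ψ)] : E3)‖ =
        √(Real.cos φ ^ 2 + Real.cos θ ^ 2 * Real.sin φ ^ 2) := by
    intro ψ hψ
    rw [norm_eq_sqrt_real_inner, inner_fin_three]
    congr 1
    rcases hψ with h | h <;> rw [h] <;> simp <;>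
      linear_combination (Real.cos φ ^ 2) * Real.sin_sq_add_cos_sq θ
  refine ⟨(√(Real.cos φ ^ 2 + Real.cos θ ^ 2 * Real.sin φ ^ 2))⁻¹, ?_, ?_⟩
  · rw [inv_pow, Real.sq_sqrt (by positivity)]
  · intro ψ hψ
    simp only [coneRay, hn ψ hψ]
    simp

/-- The field is constant away from the corner, so all rotation comes from `cornerTransport`. In the
plane of the surface the two copies of the corner are mirror images, with coordinates `N * (cos (Θ /
2), ± cos θ * sin (Θ / 2))`. The sine of the rotation from one to the other is the claimed value,
whatever the initial vector. -/
theorem IsIntegratedCurvature.eq {θ Θ κ : ℝ} (hΘ : 0 ≤ Θ) (h : IsIntegratedCurvature θ Θ κ) :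
    κ = tiltedConeCurvature (Real.cos θ) (2 * Real.pi - Θ) := by
  obtain ⟨X, hX, hp, rfl⟩ := h
  have hab : -(Θ / 2) ≤ Θ / 2 := by linarith
  rw [eq_of_parallel (norm_coneNormal θ) hab hp]
  have hn := (hp _ (left_mem_Icc.2 hab)).1
  generalize X (-(Θ / 2)) = u at hX hn
  clear hp
  have hε : (2 * Real.pi - Θ) / 2 = Real.pi - Θ / 2 := by ring
  have hs : Real.sin (2 * Real.pi - Θ) = -(2 * Real.sin (Θ / 2) * Real.cos (Θ / 2)) := by
    rw [Real.sin_two_pi_sub, ← Real.sin_two_mul]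
    ring_nf
  rw [tiltedConeCurvature, hε, Real.cos_pi_sub, Real.sin_pi_sub, hs, neg_sq, div_eq_mul_inv]
  obtain ⟨N, hN, hr⟩ := coneRay_apply θ (Θ / 2)
  rw [← hN]
  obtain ⟨p0, p1, p2⟩ := hr _ (Or.inl rfl)
  obtain ⟨m0, m1, m2⟩ := hr _ (Or.inr rfl)
  rw [Real.cos_neg] at m0 m2
  rw [Real.sin_neg] at m1
  obtain ⟨jp0, jp1, jp2⟩ := coneTurn_apply θ (coneRay θ (Θ / 2))
  obtain ⟨jm0, jm1, jm2⟩ := coneTurn_apply θ (coneRay θ (-(Θ / 2)))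
  obtain ⟨ju0, ju1, ju2⟩ := coneTurn_apply θ u
  rw [p1] at jp0 jp2
  rw [p0, p2] at jp1
  rw [m1] at jm0 jm2
  rw [m0, m2] at jm1
  have hcs := Real.sin_sq_add_cos_sq θ
  rw [inner_fin_three] at hn
  simp only [coneNormal, Matrix.cons_val_zero, Matrix.cons_val_one, Matrix.cons_val, PiLp.toLp_apply] at hn
  have hu : u 0 * u 0 + u 1 * u 1 + u 2 * u 2 = 1 := by
    rw [← inner_fin_three, real_inner_self_eq_norm_sq, hX, one_pow]
  rw [cornerTransport, inner_fin_three (_ + _)]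
  simp only [PiLp.add_apply, PiLp.smul_apply, smul_eq_mul, inner_fin_three,
    p0, p1, p2, m0, m1, m2, jp0, jp1, jp2, jm0, jm1, jm2, ju0, ju1, ju2]
  generalize Real.cos θ = c at *
  generalize Real.sin θ = s at *
  generalize Real.cos (Θ / 2) = A at *
  generalize Real.sin (Θ / 2) = B at *
  -- `(x, y)` are the coordinates of `u` in the orthonormal basis `(c, 0, -s)`, `(0, 1, 0)` of the
  -- tangent plane.
  obtain ⟨x, hx⟩ : ∃ x, x = c * u 0 - s * u 2 := ⟨_, rfl⟩
  have h0 : u 0 = c * x := by rw [hx]; linear_combination (-u 0) * hcs + s * hn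
  have h2 : u 2 = -(s * x) := by rw [hx]; linear_combination (-u 2) * hcs + c * hn
  generalize u 0 = u0 at *
  generalize u 1 = y at *
  generalize u 2 = u2 at *
  subst h0 h2
  have hxy : x ^ 2 + y ^ 2 = 1 := by linear_combination hu - x ^ 2 * hcs
  have hc : c * (c * x) - s * -(s * x) = x := by linear_combination x * hcs
  have hi : N * (c * A) * (c * x) + N * (c * B) * y + N * -(s * A) * -(s * x) =
      N * (A * x + c * B * y) := by linear_combination N * A * x * hcs
  have hA : c * (N * (c * A)) - s * (N * -(s * A)) = N * A := by linear_combination N * A * hcs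
  have hj : -(c * (N * (c * B))) * (c * x) + N * A * y + s * (N * (c * B)) * -(s * x) =
      N * (A * y - c * B * x) := by linear_combination -N * c * B * x * hcs
  rw [hc, hA, hi, hj]
  linear_combination (-2 * c * A * B * N ^ 2) * hxy -
    N ^ 2 * (2 * A * B * c * y ^ 2 + A ^ 2 * x * y - c ^ 2 * B ^ 2 * x * y) * hcs

/-! ### Edges: parametrisation, length, and height along a hinge. -/

namespace PiecewiseFlatComplex

theorem coneAngle_nonneg {V : Type u} [DecidableEq V] (S : PiecewiseFlatComplex V) (h : Finset V) :
    0 ≤ S.coneAngle h := by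
  refine finsum_nonneg fun t => finsum_nonneg fun _ => ?_
  exact div_nonneg (Finset.sum_nonneg fun p _ => InnerProductGeometry.angle_nonneg _ _) two_pos.le

section Simplices

variable {V : Type u} (S : PiecewiseFlatComplex V)

theorem closedSimplex_mono {s t : Finset V} (h : s ⊆ t) : S.closedSimplex s ⊆ S.closedSimplex t :=
  fun _ hx u hu => hx u fun hs => hu (h hs)

theorem openSimplex_subset_closedSimplex (s : Finset V) : S.openSimplex s ⊆ S.closedSimplex s :=
  fun x hx u hu => le_antisymm (not_lt.1 fun h => hu ((hx u).2 h)) (x.2.1 u)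

theorem eq_of_mem_openSimplex {s t : Finset V} {x : S.Space} (hs : x ∈ S.openSimplex s)
    (ht : x ∈ S.openSimplex t) : s = t := by
  ext u
  rw [hs u, ht u]

theorem someTet_spec {h : Finset V} (hE : h ∈ S.edges) :
    S.someTet h ∈ S.tets ∧ h ⊆ S.someTet h :=
  Classical.epsilon_spec hE.2

/-- The edges at `v` or `w`. -/
theorem finite_edges_at (v w : V) : {h ∈ S.edges | v ∈ h ∨ w ∈ h}.Finite := by
  have h1 : ((⋃ t ∈ {t ∈ S.tets | v ∈ t}, ((t.powerset : Finset (Finset V)) : Set (Finset V))) ∪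
      ⋃ t ∈ {t ∈ S.tets | w ∈ t}, ((t.powerset : Finset (Finset V)) : Set (Finset V))).Finite :=
    ((S.locallyFinite v).biUnion fun t _ => Finset.finite_toSet _).union
      ((S.locallyFinite w).biUnion fun t _ => Finset.finite_toSet _)
  refine h1.subset ?_
  rintro h ⟨⟨-, t, ht, hht⟩, hv | hw⟩
  · exact Or.inl (mem_biUnion (x := t) ⟨ht, hht hv⟩ (by simpa using hht))
  · exact Or.inr (mem_biUnion (x := t) ⟨ht, hht hw⟩ (by simpa using hht))

theorem lengthIn_nonneg (h : Finset V) (A : Set S.Space) : 0 ≤ S.lengthIn h A :=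
  ENNReal.toReal_nonneg

end Simplices

section EdgePoint

variable {V : Type u} [DecidableEq V] (S : PiecewiseFlatComplex V) {a b : V}

theorem ne_of_mem_edges (hE : ({a, b} : Finset V) ∈ S.edges) : a ≠ b := by
  rintro rfl
  have := hE.1
  simp at this

theorem exists_pair {h : Finset V} (hE : h ∈ S.edges) : ∃ a b, h = {a, b} := by
  obtain ⟨a, b, -, hab⟩ := Finset.card_eq_two.1 hE.1
  exact ⟨a, b, hab⟩

/-- The point that divides the edge `ab` in the ratio `τ : 1 - τ`. -/
noncomputable def edgePoint (hE : ({a, b} : Finset V) ∈ S.edges) (τ : ℝ) : S.Space :=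
  -- Clamping `τ` to `[0, 1]` makes the map defined and continuous on the whole line.
  ⟨fun u => (if u = a then 1 - max 0 (min τ 1) else 0) + (if u = b then max 0 (min τ 1) else 0), by
    have h0 : 0 ≤ max 0 (min τ 1) := le_max_left _ _
    have h1 : max 0 (min τ 1) ≤ 1 := max_le zero_le_one (min_le_right _ _)
    refine ⟨fun u => ?_, ?_⟩
    · dsimp only
      split_ifs <;> linarith
    · obtain ⟨t, ht, hab⟩ := hE.2
      have ha : a ∈ t := hab (by simp)
      have hb : b ∈ t := hab (by simp)
      refine ⟨t, ht, fun u hu => ?_, ?_⟩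
      · have h1 : u ≠ a := fun h => hu (h ▸ ha)
        have h2 : u ≠ b := fun h => hu (h ▸ hb)
        simp [h1, h2]
      · simp [Finset.sum_add_distrib, ha, hb]⟩

variable (hE : ({a, b} : Finset V) ∈ S.edges)

theorem continuous_edgePoint : Continuous (S.edgePoint hE) := by
  refine Continuous.subtype_mk (continuous_pi fun u => ?_) _
  split_ifs <;> fun_prop

theorem edgePoint_val {τ : ℝ} (hτ : τ ∈ Icc (0 : ℝ) 1) (u : V) :
    (S.edgePoint hE τ).1 u = (if u = a then 1 - τ else 0) + (if u = b then τ else 0) := by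
  simp [edgePoint, min_eq_left hτ.2, max_eq_right hτ.1]

theorem edgePoint_left {τ : ℝ} (hτ : τ ∈ Icc (0 : ℝ) 1) : (S.edgePoint hE τ).1 a = 1 - τ := by
  simp [edgePoint_val S hE hτ, S.ne_of_mem_edges hE]

theorem edgePoint_right {τ : ℝ} (hτ : τ ∈ Icc (0 : ℝ) 1) : (S.edgePoint hE τ).1 b = τ := by
  simp [edgePoint_val S hE hτ, (S.ne_of_mem_edges hE).symm]

theorem edgePoint_of_ne {τ : ℝ} {u : V} (ha : u ≠ a) (hb : u ≠ b) :
    (S.edgePoint hE τ).1 u = 0 := by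
  simp [edgePoint, ha, hb]

theorem injOn_edgePoint : InjOn (S.edgePoint hE) (Icc 0 1) := by
  intro x hx y hy h
  rw [← S.edgePoint_right hE hx, ← S.edgePoint_right hE hy, h]

theorem edgePoint_mem_closedSimplex (τ : ℝ) : S.edgePoint hE τ ∈ S.closedSimplex {a, b} := by
  intro u hu
  simp only [Finset.mem_insert, Finset.mem_singleton, not_or] at hu
  exact S.edgePoint_of_ne hE hu.1 hu.2

/-- The coordinates vanish outside `s` and outside the tetrahedron `t` that carries the point, so
both sums reduce to `s ∩ t`. -/
theorem sum_of_mem_closedSimplex {s : Finset V} {x : S.Space} (hx : x ∈ S.closedSimplex s) :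
    ∑ u ∈ s, x.1 u = 1 := by
  obtain ⟨t, -, ht0, ht1⟩ := x.2.2
  refine Eq.trans ?_ ht1
  rw [← Finset.sum_subset (Finset.inter_subset_left (s₂ := t)),
    Finset.sum_subset (Finset.inter_subset_right (s₁ := s))]
  · intro u hu hu'
    exact hx u fun h => hu' (Finset.mem_inter.2 ⟨h, hu⟩)
  · intro u hu hu'
    exact ht0 u fun h => hu' (Finset.mem_inter.2 ⟨hu, h⟩)

theorem exists_edgePoint_eq {x : S.Space} (hx : x ∈ S.closedSimplex {a, b}) :
    x.1 b ∈ Icc (0 : ℝ) 1 ∧ S.edgePoint hE (x.1 b) = x := by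
  have hab := S.ne_of_mem_edges hE
  have h1 := S.sum_of_mem_closedSimplex hx
  rw [Finset.sum_pair hab] at h1
  have ha := x.2.1 a
  have hb := x.2.1 b
  have hI : x.1 b ∈ Icc (0 : ℝ) 1 := ⟨hb, by linarith⟩
  refine ⟨hI, Subtype.ext (funext fun u => ?_)⟩
  by_cases hua : u = a
  · rw [hua, S.edgePoint_left hE hI]
    linarith
  by_cases hub : u = b
  · rw [hub, S.edgePoint_right hE hI]
  · rw [S.edgePoint_of_ne hE hua hub, hx u (by simp [hua, hub])]

theorem edgePoint_mem_openSimplex {τ : ℝ} (hτ : τ ∈ Ioo (0 : ℝ) 1) :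
    S.edgePoint hE τ ∈ S.openSimplex {a, b} := by
  intro u
  have hI := Ioo_subset_Icc_self hτ
  by_cases hua : u = a
  · rw [hua, S.edgePoint_left hE hI]
    simpa using hτ.2
  by_cases hub : u = b
  · rw [hub, S.edgePoint_right hE hI]
    simpa using hτ.1
  · rw [S.edgePoint_of_ne hE hua hub]
    simp [hua, hub]

theorem image_edgePoint_Ioo : S.edgePoint hE '' Ioo 0 1 = S.openSimplex {a, b} := by
  apply subset_antisymm (by rintro _ ⟨τ, hτ, rfl⟩; exact S.edgePoint_mem_openSimplex hE hτ)
  intro x hx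
  obtain ⟨hI, hx'⟩ := S.exists_edgePoint_eq hE (S.openSimplex_subset_closedSimplex _ hx)
  refine ⟨x.1 b, ⟨(hx b).1 (by simp), lt_of_le_of_ne hI.2 fun h => ?_⟩, hx'⟩
  have h1 := S.edgePoint_left hE hI
  rw [hx', h, sub_self] at h1
  exact ((hx a).1 (by simp)).ne' h1

theorem image_edgePoint_Icc : S.edgePoint hE '' Icc 0 1 = S.closedSimplex {a, b} :=
  subset_antisymm (by rintro _ ⟨τ, -, rfl⟩; exact S.edgePoint_mem_closedSimplex hE τ)
    fun x hx => ⟨x.1 b, S.exists_edgePoint_eq hE hx⟩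

theorem chart_edgePoint {t : Finset V} (hab : {a, b} ⊆ t) {τ : ℝ} (hτ : τ ∈ Icc (0 : ℝ) 1) :
    S.chart t (S.edgePoint hE τ) = AffineMap.lineMap (S.pos t a) (S.pos t b) τ := by
  rw [chart, ← Finset.sum_subset hab fun u _ hu => by
    rw [S.edgePoint_mem_closedSimplex hE τ u hu, zero_smul],
    Finset.sum_pair (S.ne_of_mem_edges hE), S.edgePoint_left hE hτ, S.edgePoint_right hE hτ,
    AffineMap.lineMap_apply_module]

/-- The distance between the ends of an edge. -/
noncomputable def edgeDist (S : PiecewiseFlatComplex V) (a b : V) : ℝ :=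
  dist (S.pos (S.someTet {a, b}) a) (S.pos (S.someTet {a, b}) b)

include hE in
theorem dist_eq_edgeDist {t : Finset V} (ht : t ∈ S.tets) (hab : {a, b} ⊆ t) :
    dist (S.pos t a) (S.pos t b) = S.edgeDist a b := by
  obtain ⟨h1, h2⟩ := S.someTet_spec hE
  exact S.dist_pos t ht _ h1 a b (hab (by simp)) (h2 (by simp)) (hab (by simp)) (h2 (by simp))

include hE in
theorem edgeDist_pos : 0 < S.edgeDist a b := by
  obtain ⟨h1, h2⟩ := S.someTet_spec hE
  refine _root_.dist_pos.2 fun h => S.ne_of_mem_edges hE ?_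
  have := (S.affineIndependent _ h1).injective (a₁ := ⟨a, h2 (by simp)⟩) (a₂ := ⟨b, h2 (by simp)⟩) h
  simpa using this

/-- The chart is affine along the edge and scales one-dimensional Hausdorff measure by the edge
length. The endpoints are a null set. -/
theorem lengthIn_eq (A : Set S.Space) : S.lengthIn {a, b} A =
    S.edgeDist a b * (MeasureTheory.volume {τ | τ ∈ Ioo (0 : ℝ) 1 ∧ S.edgePoint hE τ ∈ A}).toReal := by
  have h1 : S.chart (S.someTet {a, b}) '' (A ∩ S.closedSimplex {a, b}) =
      AffineMap.lineMap (S.pos (S.someTet {a, b}) a) (S.pos (S.someTet {a, b}) b) ''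
        {τ | τ ∈ Icc (0 : ℝ) 1 ∧ S.edgePoint hE τ ∈ A} := by
    rw [← S.image_edgePoint_Icc hE]
    ext y
    constructor
    · rintro ⟨_, ⟨hA, τ, hτ, rfl⟩, rfl⟩
      exact ⟨τ, ⟨hτ, hA⟩, (S.chart_edgePoint hE (S.someTet_spec hE).2 hτ).symm⟩
    · rintro ⟨τ, ⟨hτ, hA⟩, rfl⟩
      exact ⟨_, ⟨hA, τ, hτ, rfl⟩, S.chart_edgePoint hE (S.someTet_spec hE).2 hτ⟩
  have h2 : MeasureTheory.volume {τ | τ ∈ Icc (0 : ℝ) 1 ∧ S.edgePoint hE τ ∈ A} =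
      MeasureTheory.volume {τ | τ ∈ Ioo (0 : ℝ) 1 ∧ S.edgePoint hE τ ∈ A} := by
    apply measure_congr
    exact (Ioo_ae_eq_Icc (μ := MeasureTheory.volume) (a := (0 : ℝ)) (b := 1)).symm.inter
      (ae_eq_refl (S.edgePoint hE ⁻¹' A))
  rw [lengthIn, h1, hausdorffMeasure_lineMap_image, hausdorffMeasure_real, h2, ENNReal.toReal_smul]
  rfl

include hE in
theorem length_eq : S.length {a, b} = S.edgeDist a b := by
  have h : {τ | τ ∈ Ioo (0 : ℝ) 1 ∧ S.edgePoint hE τ ∈ (univ : Set S.Space)} = Ioo 0 1 :=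
    inter_univ _
  rw [length, S.lengthIn_eq hE, h]
  simp

theorem axial_edgePoint {t : Finset V} (ht : t ∈ S.tets) (hab : {a, b} ⊆ t) {τ : ℝ}
    (hτ : τ ∈ Icc (0 : ℝ) 1) : S.axial t a b (S.edgePoint hE τ) = τ * S.edgeDist a b := by
  have h1 : ‖S.pos t b - S.pos t a‖ = S.edgeDist a b := by
    rw [← S.dist_eq_edgeDist hE ht hab, dist_comm, dist_eq_norm]
  rw [axial, S.chart_edgePoint hE hab hτ, dir, AffineMap.lineMap_apply, vsub_eq_sub, vadd_eq_add,
    add_sub_cancel_right, inner_smul_left, inner_smul_right, real_inner_self_eq_norm_sq, h1]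
  have := (S.edgeDist_pos hE).ne'
  simp
  field_simp

theorem axial_swap_edgePoint {t : Finset V} (ht : t ∈ S.tets) (hab : {a, b} ⊆ t) {τ : ℝ}
    (hτ : τ ∈ Icc (0 : ℝ) 1) : S.axial t b a (S.edgePoint hE τ) = (1 - τ) * S.edgeDist a b := by
  have h1 : ‖S.pos t a - S.pos t b‖ = S.edgeDist a b := by
    rw [← S.dist_eq_edgeDist hE ht hab, dist_eq_norm]
  have h2 : (AffineMap.lineMap (S.pos t a) (S.pos t b) τ : E3) - S.pos t b =
      (1 - τ) • (S.pos t a - S.pos t b) := by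
    rw [AffineMap.lineMap_apply_module]
    module
  rw [axial, S.chart_edgePoint hE hab hτ, dir, h2, inner_smul_left, inner_smul_right,
    real_inner_self_eq_norm_sq, h1]
  have := (S.edgeDist_pos hE).ne'
  simp
  field_simp

/-- This removes the radial term of a tilted foliation on the hinge itself, leaving only the axial
one. -/
theorem perp_edgePoint {t : Finset V} (hab : {a, b} ⊆ t) {τ : ℝ}
    (hτ : τ ∈ Icc (0 : ℝ) 1) : S.perp t {a, b} (S.chart t (S.edgePoint hE τ)) = 0 := by
  rw [perp, S.chart_edgePoint hE hab hτ]
  rw [Submodule.starProjection_apply_eq_zero_iff, Submodule.orthogonal_orthogonal]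
  have hm : ∀ u ∈ ({a, b} : Finset V),
      S.pos t u ∈ affineSpan ℝ (S.pos t '' (({a, b} : Finset V) : Set V)) := fun u hu =>
    subset_affineSpan ℝ _ (mem_image_of_mem _ hu)
  rw [← direction_affineSpan]
  refine AffineSubspace.vsub_mem_direction (AffineMap.lineMap_mem _ (hm a (by simp))
    (hm b (by simp))) ?_
  rw [Finset.centroid_pair]
  exact AffineMap.lineMap_mem _ (hm a (by simp)) (hm b (by simp))

/-- Along a hinge, a foliation by tilted surfaces is affine. -/
theorem IsTiltedFoliationAt.eventually_edgePoint {S : PiecewiseFlatComplex V}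
    {hE : ({a, b} : Finset V) ∈ S.edges} {θ : ℝ}
    {f : S.Space → ℝ} {r : ℝ} (hr : r ∈ Ioo (0 : ℝ) 1)
    (h : S.IsTiltedFoliationAt {a, b} θ f (S.edgePoint hE r)) :
    ∃ σ : ℝ, |σ| = |Real.cos θ| * S.edgeDist a b ∧
      ∀ᶠ x in 𝓝 r, f (S.edgePoint hE x) = f (S.edgePoint hE r) + σ * (x - r) := by
  obtain ⟨a', b', hab, φ, -, hev⟩ := h
  obtain ⟨t, ht, hsub⟩ := hE.2
  have h1 := ((S.continuous_edgePoint hE).tendsto r).eventually hev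
  have h2 : ∀ᶠ x in 𝓝 r, x ∈ Ioo (0 : ℝ) 1 := isOpen_Ioo.mem_nhds hr
  have hd := S.edgeDist_pos hE
  have hkey : ∀ᶠ x in 𝓝 r, f (S.edgePoint hE x) = f (S.edgePoint hE r) +
      Real.cos θ * (S.axial t a' b' (S.edgePoint hE x) - S.axial t a' b' (S.edgePoint hE r)) := by
    filter_upwards [h1, h2] with x hx hx'
    rw [hx t ht hsub (S.closedSimplex_mono hsub (S.edgePoint_mem_closedSimplex hE x)),
      S.perp_edgePoint hE hsub (Ioo_subset_Icc_self hx'), norm_zero]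
    ring
  -- The foliation may orient the hinge either way; reversal only changes the sign of the slope.
  have hcase : (a' = a ∧ b' = b) ∨ (a' = b ∧ b' = a) := by
    have h3 : ({a', b'} : Finset V) = {a, b} := hab.symm
    have hne := S.ne_of_mem_edges hE
    have ha : a ∈ ({a', b'} : Finset V) := by rw [h3]; simp
    have hb : b ∈ ({a', b'} : Finset V) := by rw [h3]; simp
    simp only [Finset.mem_insert, Finset.mem_singleton] at ha hb
    grind
  rcases hcase with ⟨rfl, rfl⟩ | ⟨rfl, rfl⟩
  · refine ⟨Real.cos θ * S.edgeDist a' b', by rw [abs_mul, abs_of_pos hd], ?_⟩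
    filter_upwards [hkey, h2] with x hx hx'
    rw [hx, S.axial_edgePoint hE ht hsub (Ioo_subset_Icc_self hx'),
      S.axial_edgePoint hE ht hsub (Ioo_subset_Icc_self hr)]
    ring
  · refine ⟨-(Real.cos θ * S.edgeDist b' a'), by rw [abs_neg, abs_mul, abs_of_pos hd], ?_⟩
    filter_upwards [hkey, h2] with x hx hx'
    rw [hx, S.axial_swap_edgePoint hE ht hsub (Ioo_subset_Icc_self hx'),
      S.axial_swap_edgePoint hE ht hsub (Ioo_subset_Icc_self hr)]
    ring

end EdgePoint

end PiecewiseFlatComplex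

/-! ### Summing the curvature over the hinges of the edge volume. -/

namespace PiecewiseFlatComplex.OrthogonalSurfaces

variable {V : Type u} [DecidableEq V] {S : PiecewiseFlatComplex V} {D : V → Set S.Space} {v w : V}
  (P : S.OrthogonalSurfaces D v w)

theorem cos_angle_nonneg (h : Finset V) : 0 ≤ Real.cos (P.angle h) :=
  Real.cos_nonneg_of_mem_Icc ⟨by linarith [(P.angle_mem h).1, Real.pi_pos], (P.angle_mem h).2⟩

theorem isOpen_edgeVolume (hD : S.IsDualTessellation D) : IsOpen P.edgeVolume :=
  ((hD.isOpen v).union (hD.isOpen w)).inter P.isOpen_domain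

theorem isTiltedFoliationAt {h : Finset V} {q : S.Space} (hq : q ∈ S.openSimplex h)
    (hE : h ∈ S.edges) (hqP : q ∈ P.domain) :
    S.IsTiltedFoliationAt h (P.angle h) P.height q := by
  rcases P.developed q hqP with ⟨h', -, hq', ht⟩ | ⟨hno, -⟩
  · rwa [S.eq_of_mem_openSimplex hq hq']
  · exact absurd (S.openSimplex_subset_closedSimplex h hq) (hno h hE)

/-- The points of a hinge in the edge volume, in the surface through the point at distance `s`. -/
noncomputable def hingeFiber (h : Finset V) (s : ℝ) : Set S.Space :=
  {q | q ∈ P.edgeVolume ∧ q ∈ S.openSimplex h ∧ P.height q = s}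

/-- The number of intersection points of a hinge that is not parallel to the surfaces with one of
them, integrated over the surfaces. -/
theorem exists_multiplicity (hD : S.IsDualTessellation D) {h : Finset V} (hE : h ∈ S.edges)
    (hc : 0 < Real.cos (P.angle h)) :
    ∃ N : ℝ → ENNReal, Measurable N ∧
      ∫⁻ s, N s = ENNReal.ofReal (Real.cos (P.angle h) * S.lengthIn h P.edgeVolume) ∧
      ∀ s, N s ≠ ⊤ → (P.hingeFiber h s).Finite ∧
        ∀ k : ℝ, ∑ᶠ q ∈ P.hingeFiber h s, k = (N s).toReal * k := by
  obtain ⟨a, b, rfl⟩ := S.exists_pair hE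
  set γ := S.edgePoint hE
  set U : Set ℝ := {τ | τ ∈ Ioo (0 : ℝ) 1 ∧ γ τ ∈ P.edgeVolume}
  have hU : IsOpen U := isOpen_Ioo.inter
    ((P.isOpen_edgeVolume hD).preimage (S.continuous_edgePoint hE))
  have hd := S.edgeDist_pos hE
  -- The parameter `τ` runs over the hinge at speed `edgeDist`. This factor recombines with the
  -- measure of `U` into `lengthIn`.
  have hslope : ∀ r ∈ U, ∃ σ : ℝ, |σ| = Real.cos (P.angle {a, b}) * S.edgeDist a b ∧
      ∀ᶠ x in 𝓝 r, (P.height ∘ γ) x = (P.height ∘ γ) r + σ * (x - r) := by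
    intro r hr
    have h1 := IsTiltedFoliationAt.eventually_edgePoint hr.1 (P.isTiltedFoliationAt
      (S.edgePoint_mem_openSimplex hE hr.1) hE hr.2.2)
    rwa [abs_of_pos hc] at h1
  obtain ⟨hm, hi⟩ := lintegral_count_fiber hU (mul_pos hc hd) hslope
  refine ⟨_, hm, ?_, fun s hs => ?_⟩
  · have hfin : MeasureTheory.volume U ≠ ⊤ :=
      measure_ne_top_of_subset (fun r hr => hr.1) measure_Ioo_lt_top.ne
    rw [hi, S.lengthIn_eq hE, ← mul_assoc, ENNReal.ofReal_mul (mul_pos hc hd).le,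
      ENNReal.ofReal_toReal hfin]
  · have hf : {r | r ∈ U ∧ (P.height ∘ γ) r = s}.Finite :=
      Measure.count_apply_lt_top.1 (lt_top_iff_ne_top.2 hs)
    have himage : P.hingeFiber {a, b} s = γ '' {r | r ∈ U ∧ (P.height ∘ γ) r = s} := by
      ext q
      constructor
      · rintro ⟨hq, hqh, hqs⟩
        rw [← S.image_edgePoint_Ioo hE] at hqh
        obtain ⟨τ, hτ, rfl⟩ := hqh
        exact ⟨τ, ⟨⟨hτ, hq⟩, hqs⟩, rfl⟩
      · rintro ⟨τ, ⟨⟨hτ, hq⟩, hqs⟩, rfl⟩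
        exact ⟨hq, S.edgePoint_mem_openSimplex hE hτ, hqs⟩
    rw [himage]
    refine ⟨hf.image _, fun k => ?_⟩
    rw [finsum_mem_image ((S.injOn_edgePoint hE).mono fun r hr => Ioo_subset_Icc_self hr.1.1),
      finsum_mem_eq_finite_toFinset_sum _ hf, Finset.sum_const, nsmul_eq_mul,
      Measure.count_apply_finite _ hf, ENNReal.toReal_natCast]

theorem mem_or_mem_of_meets (hD : S.IsDualTessellation D) {h : Finset V} (hE : h ∈ S.edges)
    {q : S.Space} (hq : q ∈ S.openSimplex h) (hqP : q ∈ P.edgeVolume) : v ∈ h ∨ w ∈ h :=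
  hqP.1.imp (fun h1 => hD.mem_of_inter v h hE ⟨q, h1, hq⟩)
    fun h1 => hD.mem_of_inter w h hE ⟨q, h1, hq⟩

theorem lengthIn_eq_zero (hD : S.IsDualTessellation D) {h : Finset V} (hE : h ∈ S.edges)
    (hh : ¬(v ∈ h ∨ w ∈ h)) : S.lengthIn h P.edgeVolume = 0 := by
  obtain ⟨a, b, rfl⟩ := S.exists_pair hE
  rw [S.lengthIn_eq hE]
  have : {τ | τ ∈ Ioo (0 : ℝ) 1 ∧ S.edgePoint hE τ ∈ P.edgeVolume} = ∅ :=
    eq_empty_of_forall_notMem fun τ hτ =>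
      hh (P.mem_or_mem_of_meets hD hE (S.edgePoint_mem_openSimplex hE hτ.1) hτ.2)
  rw [this, measure_empty, ENNReal.toReal_zero, mul_zero]

theorem edgePoint_mem_domain (hE : ({v, w} : Finset V) ∈ S.edges) {τ : ℝ}
    (hτ : τ ∈ Ioo (0 : ℝ) 1) : S.edgePoint hE τ ∈ P.domain := by
  obtain ⟨t, ht, hsub⟩ := hE.2
  have hI := Ioo_subset_Icc_self hτ
  have hd := S.edgeDist_pos hE
  refine (P.orthogonal t ht (hsub (by simp)) (hsub (by simp)) _
    (S.closedSimplex_mono hsub (S.edgePoint_mem_closedSimplex hE τ)) ?_ ?_).1.2 ?_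
  · rw [S.edgePoint_left hE hI]
    linarith [hτ.2]
  · rw [S.edgePoint_right hE hI]
    exact hτ.1
  · rw [S.axial_edgePoint hE ht hsub hI, S.length_eq hE]
    exact ⟨mul_pos hτ.1 hd, by nlinarith [hτ.2]⟩

/-- With this, `ℓ` enters the sum as one more hinge, orthogonal to the surfaces. -/
theorem cos_angle_edge (hE : ({v, w} : Finset V) ∈ S.edges) :
    Real.cos (P.angle {v, w}) = 1 := by
  obtain ⟨t, ht, hsub⟩ := hE.2
  have hhalf : (1 / 2 : ℝ) ∈ Ioo (0 : ℝ) 1 := by norm_num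
  have hne : S.pos t w - S.pos t v ≠ 0 := by
    rw [← norm_pos_iff, ← dist_eq_norm, dist_comm, S.dist_eq_edgeDist hE ht hsub]
    exact S.edgeDist_pos hE
  rw [P.cos_angle t ht (hsub (by simp)) (hsub (by simp)) v (hsub (by simp)) w (hsub (by simp))
    (S.ne_of_mem_edges hE)
    ⟨_, S.edgePoint_mem_openSimplex hE hhalf, P.edgePoint_mem_domain hE hhalf⟩,
    real_inner_self_eq_norm_sq, dir, norm_smul, norm_inv, norm_norm,
    inv_mul_cancel₀ (norm_ne_zero_iff.2 hne)]
  simp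

/-- The open edge lies in the domain, the dual cells cover it up to a null set, and only the cells
of `v` and `w` can meet it. -/
theorem lengthIn_edge (hD : S.IsDualTessellation D) (hE : ({v, w} : Finset V) ∈ S.edges) :
    S.lengthIn {v, w} P.edgeVolume = S.length {v, w} := by
  have h0 := hD.length_compl _ hE
  rw [S.lengthIn_eq hE, mul_eq_zero, or_iff_right (S.edgeDist_pos hE).ne',
    ENNReal.toReal_eq_zero_iff, or_iff_left (measure_ne_top_of_subset (fun r hr => hr.1)
      measure_Ioo_lt_top.ne)] at h0
  have h1 : {τ | τ ∈ Ioo (0 : ℝ) 1 ∧ S.edgePoint hE τ ∈ P.edgeVolume} =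
      Ioo 0 1 \ {τ | τ ∈ Ioo (0 : ℝ) 1 ∧ S.edgePoint hE τ ∈ (⋃ u, D u)ᶜ} := by
    ext τ
    constructor
    · rintro ⟨hτ, hD', -⟩
      refine ⟨hτ, fun h => h.2 ?_⟩
      rcases hD' with h' | h'
      · exact mem_iUnion.2 ⟨v, h'⟩
      · exact mem_iUnion.2 ⟨w, h'⟩
    · rintro ⟨hτ, hn⟩
      have hU : S.edgePoint hE τ ∈ ⋃ u, D u := by
        by_contra hU
        exact hn ⟨hτ, hU⟩
      obtain ⟨u, hu⟩ := mem_iUnion.1 hU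
      have hm := hD.mem_of_inter u _ hE ⟨_, hu, S.edgePoint_mem_openSimplex hE hτ⟩
      refine ⟨hτ, ?_, P.edgePoint_mem_domain hE hτ⟩
      simp only [Finset.mem_insert, Finset.mem_singleton] at hm
      rcases hm with rfl | rfl
      · exact Or.inl hu
      · exact Or.inr hu
  rw [S.length_eq hE, S.lengthIn_eq hE, h1, measure_sdiff_null h0]
  simp

theorem surfaceCurvature_eq_zero {κ : S.Space → ℝ} {s : ℝ} (hs : s ∉ Ioo 0 (S.length {v, w})) :
    P.surfaceCurvature κ s = 0 := by
  have : {q ∈ P.edgeVolume | q ∈ S.hingePoints ∧ P.height q = s} = ∅ :=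
    eq_empty_of_forall_notMem fun q hq => hs (hq.2.2 ▸ P.height_mem q hq.1.2)
  rw [surfaceCurvature, this, finsum_mem_empty]

/-- The integral of the sectional curvature over a region around an intersection point with a
hinge, as a function of the hinge. -/
noncomputable def hingeCurvature (h : Finset V) : ℝ :=
  tiltedConeCurvature (Real.cos (P.angle h)) (S.deficit h)

theorem IsHingeCurvature.eq {P : S.OrthogonalSurfaces D v w} {κ : S.Space → ℝ}
    (hκ : P.IsHingeCurvature κ) {h : Finset V}
    (hE : h ∈ S.edges) {q : S.Space} (hq : q ∈ S.openSimplex h) (hqP : q ∈ P.edgeVolume) :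
    κ q = P.hingeCurvature h :=
  (hκ h hE q ⟨hq, hqP⟩).eq (S.coneAngle_nonneg h)

theorem surfaceCurvature_eq_sum (hD : S.IsDualTessellation D) {κ : S.Space → ℝ}
    (hκ : P.IsHingeCurvature κ) {s : ℝ} {F : Finset (Finset V)}
    (hF : ∀ h, h ∈ F ↔ (h ∈ S.edges ∧ (v ∈ h ∨ w ∈ h)) ∧ 0 < Real.cos (P.angle h))
    (hfin : ∀ h ∈ F, (P.hingeFiber h s).Finite) :
    P.surfaceCurvature κ s = ∑ h ∈ F, ∑ᶠ q ∈ P.hingeFiber h s, P.hingeCurvature h := by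
  have hdisj : (F : Set (Finset V)).PairwiseDisjoint fun h => P.hingeFiber h s := by
    intro h _ h' _ hne
    exact Set.disjoint_left.2 fun q hq hq' => hne (S.eq_of_mem_openSimplex hq.2.1 hq'.2.1)
  have h1 : P.surfaceCurvature κ s = ∑ᶠ q ∈ ⋃ h ∈ (F : Set (Finset V)), P.hingeFiber h s, κ q := by
    rw [surfaceCurvature]
    refine finsum_mem_inter_support_eq' _ _ _ fun q hq => ?_
    simp only [mem_iUnion, Finset.mem_coe, exists_prop]
    constructor
    · rintro ⟨hqP, ⟨h, hE, hqh⟩, hqs⟩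
      refine ⟨h, (hF h).2 ⟨⟨hE, P.mem_or_mem_of_meets hD hE hqh hqP⟩, ?_⟩, hqP, hqh, hqs⟩
      -- A hinge parallel to the surfaces may meet one of them in infinitely many points, but its
      -- curvature is 0 and it drops out of the support.
      refine lt_of_le_of_ne (P.cos_angle_nonneg h) fun h0 => hq ?_
      rw [hκ.eq hE hqh hqP, hingeCurvature, ← h0]
      simp [tiltedConeCurvature]
    · rintro ⟨h, hh, hqP, hqh, hqs⟩
      exact ⟨hqP, ⟨h, ((hF h).1 hh).1.1, hqh⟩, hqs⟩
  rw [h1, finsum_mem_biUnion hdisj F.finite_toSet hfin, finsum_mem_coe_finset]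
  refine Finset.sum_congr rfl fun h hh => finsum_mem_congr rfl fun q hq => ?_
  exact hκ.eq ((hF h).1 hh).1.1 hq.2.1 hq.1

/-- The integral of the surface curvatures is a sum over the hinges. -/
theorem integral_surfaceCurvature (hD : S.IsDualTessellation D) {κ : S.Space → ℝ}
    (hκ : P.IsHingeCurvature κ) {F : Finset (Finset V)}
    (hF : ∀ h, h ∈ F ↔ h ∈ S.edges ∧ (v ∈ h ∨ w ∈ h)) :
    Integrable (P.surfaceCurvature κ) ∧
      ∫ s, P.surfaceCurvature κ s = ∑ h ∈ F, S.lengthIn h P.edgeVolume *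
        (Real.cos (P.angle h) * P.hingeCurvature h) := by
  classical
  set F' := F.filter fun h => 0 < Real.cos (P.angle h) with hF'
  have hF'm : ∀ h, h ∈ F' ↔ (h ∈ S.edges ∧ (v ∈ h ∨ w ∈ h)) ∧ 0 < Real.cos (P.angle h) :=
    fun h => by rw [hF', Finset.mem_filter, hF]
  have hN : ∀ h, ∃ N : ℝ → ENNReal, h ∈ F' → Measurable N ∧
      ∫⁻ s, N s = ENNReal.ofReal (Real.cos (P.angle h) * S.lengthIn h P.edgeVolume) ∧
      ∀ s, N s ≠ ⊤ → (P.hingeFiber h s).Finite ∧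
        ∀ k : ℝ, ∑ᶠ q ∈ P.hingeFiber h s, k = (N s).toReal * k := by
    intro h
    by_cases hh : h ∈ F'
    · obtain ⟨N, hN⟩ := P.exists_multiplicity hD ((hF'm h).1 hh).1.1 ((hF'm h).1 hh).2
      exact ⟨N, fun _ => hN⟩
    · exact ⟨0, fun h' => absurd h' hh⟩
  choose N hN using hN
  have hne : ∀ h ∈ F', ∫⁻ s, N h s ≠ ⊤ := fun h hh => by
    rw [(hN h hh).2.1]
    exact ENNReal.ofReal_ne_top
  have hlt : ∀ h ∈ F', ∀ᵐ s, N h s < ⊤ := fun h hh =>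
    ae_lt_top (hN h hh).1 (hne h hh)
  -- The multiplicities have finite integrals, so almost every surface meets each hinge of `F'` in
  -- finitely many points; the other heights are negligible.
  have hae : P.surfaceCurvature κ =ᵐ[MeasureTheory.volume]
      fun s => ∑ h ∈ F', (N h s).toReal * P.hingeCurvature h := by
    have hall : ∀ᵐ s, ∀ h ∈ F', N h s < ⊤ := (Finset.eventually_all F').2 hlt
    filter_upwards [hall] with s hs
    rw [P.surfaceCurvature_eq_sum hD hκ hF'm fun h hh => ((hN h hh).2.2 s (hs h hh).ne).1]
    exact Finset.sum_congr rfl fun h hh => ((hN h hh).2.2 s (hs h hh).ne).2 _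
  have hint : ∀ h ∈ F', Integrable fun s => (N h s).toReal * P.hingeCurvature h := fun h hh =>
    (integrable_toReal_of_lintegral_ne_top (hN h hh).1.aemeasurable (hne h hh)).mul_const _
  refine ⟨(integrable_finsetSum _ hint).congr hae.symm, ?_⟩
  rw [integral_congr_ae hae, integral_finsetSum _ hint, hF', Finset.sum_filter]
  refine Finset.sum_congr rfl fun h hh => ?_
  split_ifs with hc
  · have hh' : h ∈ F' := by rw [hF', Finset.mem_filter]; exact ⟨hh, hc⟩
    rw [integral_mul_const, integral_toReal (hN h hh').1.aemeasurable (hlt h hh'),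
      (hN h hh').2.1, ENNReal.toReal_ofReal (mul_nonneg hc.le (S.lengthIn_nonneg _ _))]
    ring
  · rw [le_antisymm (not_lt.1 hc) (P.cos_angle_nonneg h)]
    ring

end PiecewiseFlatComplex.OrthogonalSurfaces

theorem mainTheorem3 :
    ∃ C : ℝ, ∀ (V : Type u) [DecidableEq V] (S : PiecewiseFlatComplex V), S.IsManifold →
      ∀ D : V → Set S.Space, S.IsDualTessellation D →
      ∀ v w : V, {v, w} ∈ S.edges →
      ∀ (P : S.OrthogonalSurfaces D v w) (κ : S.Space → ℝ), P.IsHingeCurvature κ →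
        IntervalIntegrable (P.surfaceCurvature κ) MeasureTheory.volume 0 (S.length {v, w}) ∧
        |P.averageCurvature κ -
            (S.length {v, w} * S.deficit {v, w} +
              ∑ᶠ h ∈ S.edges \ {{v, w}},
                S.lengthIn h P.edgeVolume * Real.cos (P.angle h) ^ 2 * S.deficit h) /
            (S.volume P.edgeVolume).toReal| ≤
          C * (S.length {v, w} * S.deficit {v, w} ^ 2 +
              ∑ᶠ h ∈ S.edges \ {{v, w}}, S.lengthIn h P.edgeVolume * S.deficit h ^ 2) /
            (S.volume P.edgeVolume).toReal := by
  refine ⟨2, fun V _ S _ D hD v w hE P κ hκ => ?_⟩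
  have hfin : {h ∈ S.edges | v ∈ h ∨ w ∈ h}.Finite := S.finite_edges_at v w
  set F := hfin.toFinset
  have hF : ∀ h, h ∈ F ↔ h ∈ S.edges ∧ (v ∈ h ∨ w ∈ h) := fun h => hfin.mem_toFinset
  obtain ⟨hint, hval⟩ := P.integral_surfaceCurvature hD hκ hF
  refine ⟨hint.intervalIntegrable, ?_⟩
  have hL : 0 ≤ S.length {v, w} := S.lengthIn_nonneg _ _
  have hinterval : ∫ s in (0 : ℝ)..S.length {v, w}, P.surfaceCurvature κ s =
      ∑ h ∈ F, S.lengthIn h P.edgeVolume * (Real.cos (P.angle h) * P.hingeCurvature h) := by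
    rw [intervalIntegral.integral_of_le hL, ← hval]
    exact setIntegral_eq_integral_of_forall_compl_eq_zero fun s hs =>
      P.surfaceCurvature_eq_zero fun hs' => hs (Ioo_subset_Ioc_self hs')
  have hmem : {v, w} ∈ F := (hF _).2 ⟨hE, by simp⟩
  -- Both sums in the statement have terms that vanish with `lengthIn`, so they reduce to `F`, with
  -- the term of `ℓ` split off.
  have hsum : ∀ f : Finset V → ℝ, (∀ h, S.lengthIn h P.edgeVolume = 0 → f h = 0) →
      f {v, w} + ∑ᶠ h ∈ S.edges \ {{v, w}}, f h = ∑ h ∈ F, f h := by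
    intro f hf
    rw [← Finset.add_sum_erase _ _ hmem, ← finsum_mem_coe_finset]
    congr 1
    refine finsum_mem_inter_support_eq' _ _ _ fun h hh => ?_
    simp only [Set.mem_sdiff, mem_singleton_iff, Finset.mem_coe, Finset.mem_erase, hF]
    constructor
    · rintro ⟨h1, h2⟩
      refine ⟨h2, h1, ?_⟩
      by_contra h3
      exact hh (hf h (P.lengthIn_eq_zero hD h1 h3))
    · rintro ⟨h1, h2, -⟩
      exact ⟨h2, h1⟩
  have hs1 := hsum (fun h => S.lengthIn h P.edgeVolume * Real.cos (P.angle h) ^ 2 * S.deficit h)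
    fun h h0 => by simp [h0]
  have hs2 := hsum (fun h => S.lengthIn h P.edgeVolume * S.deficit h ^ 2) fun h h0 => by simp [h0]
  simp only [P.lengthIn_edge hD hE, P.cos_angle_edge hE, one_pow, mul_one] at hs1 hs2
  rw [PiecewiseFlatComplex.OrthogonalSurfaces.averageCurvature, hinterval, hs1, hs2, ← sub_div, abs_div, abs_of_nonneg
    (ENNReal.toReal_nonneg (a := S.volume P.edgeVolume))]
  -- Nonnegativity suffices: for zero or infinite volume `toReal` is 0, and both quotients are 0.
  refine div_le_div_of_nonneg_right ?_ ENNReal.toReal_nonneg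
  rw [← Finset.sum_sub_distrib, Finset.mul_sum]
  refine (Finset.abs_sum_le_sum_abs _ _).trans (Finset.sum_le_sum fun h _ => ?_)
  have h1 := abs_mul_tiltedConeCurvature_sub_le (P.cos_angle_nonneg h)
    (Real.cos_le_one (P.angle h)) (S.deficit h)
  have h2 := S.lengthIn_nonneg h P.edgeVolume
  calc _ = |S.lengthIn h P.edgeVolume * (Real.cos (P.angle h) * P.hingeCurvature h -
        Real.cos (P.angle h) ^ 2 * S.deficit h)| := by ring_nf
    _ ≤ S.lengthIn h P.edgeVolume * (2 * S.deficit h ^ 2) := by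
        rw [abs_mul, abs_of_nonneg h2]
        exact mul_le_mul_of_nonneg_left h1 h2
    _ = _ := by ring
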